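/- All graphs are finite, simple and undirected. A graph $H$ with vertex set $\{1,\dots,n\}$ is a threshold graph if there are real numbers $a_1,\dots,a_n,b$ such that the zero-one solutions of $\sum_{i=1}^n a_i x_i\le b$ are exactly the characteristic vectors of the cliques of $H$. The threshold dimension $\mathrm{dim}_{\mathrm{TH}}(G)$ of a graph $G$ is the least $k$ such that $G=G_1\cap\dots\cap G_k$ (intersection of edge sets) for some threshold graphs $G_1,\dots,G_k$ on the vertex set of $G$; here the empty intersection ($k=0$) is the complete graph. **Theorem.** There are functions $\varepsilon_1,\varepsilon_2:\mathbb N\to\mathbb R$ with $\varepsilon_1(\Delta)\to0$ and $\varepsilon_2(\Delta)\to0$ as $\Delta\to\infty$ such that, for all sufficiently large $\Delta$, every graph $G$ of maximum degree $\Delta$ satisfies $$\mathrm{dim}_{\mathrm{TH}}(G)\le(24300+\varepsilon_1(\Delta))\,\Delta\,(\ln\Delta)^2\,(\ln\ln\Delta)\,(2e)^{\sqrt{(1+\varepsilon_2(\Delta))\ln\ln\Delta}} .$$ Moreover, for every integer $\Delta\ge0$ the maximum $\mathrm{dim}_{\mathrm{TH}}(\Delta):=\max\{\mathrm{dim}_{\mathrm{TH}}(G):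 G\text{ is a graph of maximum degree }\Delta\}$ exists, and there is a function $\eta:\mathbb N\to\mathbb R$ with $\eta(\Delta)\to0$ as $\Delta\to\infty$ such that $$\mathrm{dim}_{\mathrm{TH}}(\Delta)=O\!\left(\Delta\,(\ln\Delta)^{2+\eta(\Delta)}\right)\qquad(\Delta\to\infty).$$ -/

import Mathlib

open Filter Topology Asymptotics

/-- A graph on a finite vertex set is a threshold graph if, for some real coefficients `a v` and
some real `b`, the zero-one solutions of `∑ a v * x v ≤ b` are exactly the characteristic vectors
of the cliques. A zero-one vector is given here by its support `S`, and then
`∑ v, a v * x v = ∑ v ∈ S, a v`. -/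
def SimpleGraph.IsThreshold {V : Type*} (H : SimpleGraph V) : Prop :=
  ∃ (a : V → ℝ) (b : ℝ), ∀ S : Finset V, ∑ v ∈ S, a v ≤ b ↔ H.IsClique (S : Set V)

/-- `G` is the intersection of `k` threshold graphs on the same vertex set. (The infimum of simple
graphs on `V` is the graph whose edges are the common edges; for `k = 0` it is the complete
graph.) -/
def SimpleGraph.IsInterThreshold {V : Type*} (G : SimpleGraph V) (k : ℕ) : Prop :=
  ∃ H : Fin k → SimpleGraph V, (∀ i, (H i).IsThreshold) ∧ G = ⨅ i, H i

/-- Every finite graph is an intersection of finitely many threshold graphs, so that the minimum in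
the definition of the threshold dimension exists. -/
theorem SimpleGraph.exists_isInterThreshold {V : Type*} [Finite V] (G : SimpleGraph V) :
    ∃ k, G.IsInterThreshold k := by
  classical
  have := Fintype.ofFinite V
  let K : V → SimpleGraph V := fun u =>
    { Adj := fun x y => x ≠ y ∧ ((x = u ∨ y = u) → G.Adj x y)
      symm := ⟨fun x y h => ⟨h.1.symm, fun h' => (h.2 h'.symm).symm⟩⟩
      loopless := ⟨fun x h => h.1 rfl⟩ }
  have hK : ∀ u x y, (K u).Adj x y ↔ x ≠ y ∧ ((x = u ∨ y = u) → G.Adj x y) :=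
    fun _ _ _ => Iff.rfl
  have hthr : ∀ u, (K u).IsThreshold := by
    intro u
    let N : Finset V := Finset.univ.filter fun v => v ≠ u ∧ ¬ G.Adj u v
    let c : V → ℝ := fun v => if v ∈ N then 1 else 0
    have hc : ∀ v, 0 ≤ c v := fun v => by
      simp only [c]; split_ifs <;> norm_num
    have huN : u ∉ N := by simp [N]
    have hcu : c u = 0 := by simp [c, huN]
    have hsum : ∀ T : Finset V, ∑ v ∈ T, c v ≤ (N.card : ℝ) := by
      intro T
      simp only [c, Finset.sum_ite_mem, Finset.sum_const, nsmul_eq_mul, mul_one]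
      exact_mod_cast Finset.card_le_card Finset.inter_subset_right
    refine ⟨fun v => c v + if v = u then (N.card : ℝ) else 0, N.card, fun S => ?_⟩
    rw [Finset.sum_add_distrib, Finset.sum_ite_eq']
    by_cases hu : u ∈ S
    · rw [if_pos hu]
      constructor
      · intro h x hx y hy hxy
        have h0 : ∑ v ∈ S, c v ≤ 0 := by linarith
        have hz : ∀ v ∈ S, v ∉ N := by
          intro v hv hvN
          have h1 : c v ≤ ∑ v ∈ S, c v := Finset.single_le_sum (fun i _ => hc i) hv
          have h2 : c v = 1 := by simp [c, hvN]
          linarith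
        refine (hK u x y).2 ⟨hxy, ?_⟩
        have hadj : ∀ v ∈ S, v ≠ u → G.Adj u v := by
          intro v hv hvu
          by_contra hn
          exact hz v hv (by simp [N, hvu, hn])
        rintro (rfl | rfl)
        · exact hadj y hy hxy.symm
        · exact (hadj x hx hxy).symm
      · intro h
        have h0 : ∑ v ∈ S, c v = 0 := by
          refine Finset.sum_eq_zero fun v hv => ?_
          by_cases hvu : v = u
          · rw [hvu, hcu]
          · have h1 := ((hK u u v).1 (h hu hv (Ne.symm hvu))).2 (Or.inl rfl)
            simp [c, N, h1]
        linarith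
    · rw [if_neg hu, add_zero]
      refine ⟨fun _ x hx y hy hxy => (hK u x y).2 ⟨hxy, ?_⟩, fun _ => hsum S⟩
      rintro (rfl | rfl)
      · exact absurd hx hu
      · exact absurd hy hu
  refine ⟨Fintype.card V, fun i => K ((Fintype.equivFin V).symm i), fun i => hthr _, ?_⟩
  rw [(Fintype.equivFin V).symm.iInf_comp (g := K)]
  ext x y
  rw [SimpleGraph.iInf_adj]
  constructor
  · exact fun h => ⟨fun i => (hK i x y).2 ⟨h.ne, fun _ => h⟩, h.ne⟩
  · exact fun h => ((hK x x y).1 (h.1 x)).2 (Or.inl rfl)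

open Classical in
/-- The threshold dimension of a finite graph: the least `k` such that the graph is the
intersection of `k` threshold graphs. -/
noncomputable def SimpleGraph.thresholdDim {V : Type*} [Finite V] (G : SimpleGraph V) : ℕ :=
  Nat.find G.exists_isInterThreshold

open Classical in
/-- The threshold dimensions of all finite graphs of maximum degree `Δ` (up to isomorphism, their
vertex sets are the sets `Fin n`). -/
def thresholdDimsOfMaxDegree (Δ : ℕ) : Set ℕ :=
  {k | ∃ (n : ℕ) (G : SimpleGraph (Fin n)), G.maxDegree = Δ ∧ G.thresholdDim = k}

/-- The maximum of the threshold dimension over all finite graphs of maximum degree `Δ`. -/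
noncomputable def maxThresholdDim (Δ : ℕ) : ℕ := sSup (thresholdDimsOfMaxDegree Δ)

/-! Maximum degree at most `D ≥ 32` already forces threshold dimension at most `5040 * D * log D ^
2`; since this is stronger than both asymptotic bounds, the error functions there can be zero. Split
the vertices into `O(D)` independent classes so that every vertex has fewer than `s = O(log D)`
neighbours in each class. For a class `B` and a ranking of `B`, give each vertex outside `B` the
least rank above those of its neighbours in `B`. The resulting `rankGraph` is threshold and contains
`G`, and it loses a non-edge `xy` with `x ∉ B`, `y ∈ B` exactly when `y` outranks every neighbour of
`x` in `B`. It remains to find `O((log D) ^ 2)` rankings of `B` that achieve this for all such `x`,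
`y`. The rankings come from codes. Label the vertices by `Fin m` with `m` polynomial in `D`, and
rank `B` through `p` permutations of the labels. A random permutation puts a given label after fewer
than `s` others with probability at least `1 / s`, so `p = O(s log D)` permutations suffice for all
but a tiny proportion of label tuples. The local lemma then gives a labelling in which no
neighbourhood carries a bad tuple or a repeated label. A tie between `y` and the only neighbour with
the same label is broken by a fixed vertex order or its reverse, which doubles the number of
rankings. -/

/-! ### The local lemma by counting -/

section LocalLemma

open Classical in
/-- Events of a product space that depend on complementary sets of coordinates are independent. -/
theorem card_filter_and_mul_card_le {V C : Type*} [Fintype V] [Fintype C] (A : Finset V)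
    (P Q : (V → C) → Prop) (hP : ∀ f g, (∀ x ∉ A, f x = g x) → P f → P g)
    (hQ : ∀ f g, (∀ x ∈ A, f x = g x) → Q f → Q g) :
    (Finset.univ.filter fun f => P f ∧ Q f).card * Fintype.card (V → C) ≤
      (Finset.univ.filter P).card * (Finset.univ.filter Q).card := by
  rw [← Finset.card_univ, ← Finset.card_product, ← Finset.card_product]
  -- Exchanging the coordinates in `A` between two functions is injective; the first image inherits
  -- `P`, the second `Q`.
  refine Finset.card_le_card_of_injOn
    (fun fg => (fun x => if x ∈ A then fg.2 x else fg.1 x,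
      fun x => if x ∈ A then fg.1 x else fg.2 x)) ?_ ?_
  · rintro ⟨f, g⟩ h
    simp only [Finset.coe_product, Set.mem_prod, Finset.mem_coe, Finset.mem_filter,
      Finset.mem_univ, true_and, and_true] at h ⊢
    exact ⟨hP f _ (fun x hx => by simp [hx]) h.1, hQ f _ (fun x hx => by simp [hx]) h.2⟩
  · rintro ⟨f, g⟩ - ⟨f', g'⟩ - h
    simp only [Prod.mk.injEq, funext_iff] at h
    ext x
    · by_cases hx : x ∈ A
      · simpa [hx] using h.2 x
      · simpa [hx] using h.1 x
    · by_cases hx : x ∈ A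
      · simpa [hx] using h.1 x
      · simpa [hx] using h.2 x

open Classical in
/-- A form of the symmetric local lemma, proved by Rosenfeld's counting argument. -/
theorem exists_forall_not_of_card_le {ι V C : Type*} [Fintype ι] [Fintype V] [Fintype C]
    [Nonempty C] (D : ℕ) (hD : 0 < D) (e : ι → Finset V) (he : ∀ i, (e i).card ≤ D)
    (hdeg : ∀ v, (Finset.univ.filter fun i => v ∈ e i).card ≤ D)
    (Bad : ι → (V → C) → Prop) (hBad : ∀ i f g, (∀ x ∈ e i, f x = g x) → Bad i f → Bad i g)
    (hcard : ∀ i, 4 * (D : ℝ) ^ 2 * (Finset.univ.filter (Bad i)).card ≤ Fintype.card (V → C)) :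
    ∃ f, ∀ i, ¬ Bad i f := by
  set M : ℝ := ((Fintype.card (V → C) : ℕ) : ℝ) with hM
  have hMpos : 0 < M := by
    rw [hM]; exact_mod_cast Fintype.card_pos
  have hD1 : (1 : ℝ) ≤ D := by exact_mod_cast hD
  -- Only events supported inside `X` are forbidden. The claim to be proved is that adding one
  -- vertex to `X` costs at most a factor `β`.
  let good : Finset V → Finset (V → C) := fun X =>
    Finset.univ.filter fun f => ∀ i, e i ⊆ X → ¬ Bad i f
  let γ : Finset V → ℝ := fun X => (good X).card
  set β : ℝ := 1 - 1 / (2 * D) with hβ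
  have hβ0 : 0 < β := by
    rw [hβ, sub_pos, div_lt_one (by positivity)]; linarith
  have hβ1 : β ≤ 1 := by
    have : (0 : ℝ) ≤ 1 / (2 * D) := by positivity
    linarith
  have hβD : 1 / 2 ≤ β ^ D := by
    have h := one_add_mul_le_pow (a := -(1 / (2 * (D : ℝ)))) (by
      have : 1 / (2 * (D : ℝ)) ≤ 1 := by rw [div_le_one (by positivity)]; linarith
      linarith) D
    have h2 : 1 + (D : ℝ) * -(1 / (2 * D)) = 1 / 2 := by field_simp; norm_num
    rw [h2] at h
    simpa [hβ, sub_eq_add_neg] using h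
  have step : ∀ N : ℕ, ∀ X : Finset V, X.card = N → ∀ v ∉ X, β * γ X ≤ γ (insert v X) := by
    intro N
    induction N using Nat.strong_induction_on with
    | _ N ih =>
    intro X hX v hv
    -- Deleting `T` one vertex at a time, each deletion is an instance of the induction hypothesis
    -- for a set smaller than `X`.
    have chain : ∀ T : Finset V, T ⊆ X → β ^ T.card * γ (X \ T) ≤ γ X := by
      intro T
      induction T using Finset.induction_on with
      | empty => intro _; simp
      | insert t T ht ihT =>
        intro hT
        rw [Finset.insert_subset_iff] at hT
        refine le_trans ?_ (ihT hT.2)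
        have hmem : t ∈ X \ T := Finset.mem_sdiff.2 ⟨hT.1, ht⟩
        have heq : insert t (X \ insert t T) = X \ T := by
          rw [Finset.sdiff_insert, Finset.insert_erase hmem]
        have hlt : (X \ insert t T).card < N := by
          rw [← hX]
          refine Finset.card_lt_card (Finset.ssubset_iff_subset_ne.2 ⟨Finset.sdiff_subset, ?_⟩)
          intro h
          rw [← h] at hT
          simp at hT
        have h1 := ih _ hlt _ rfl t (by simp)
        rw [heq] at h1
        rw [Finset.card_insert_of_notMem ht, pow_succ, mul_assoc]
        exact mul_le_mul_of_nonneg_left h1 (by positivity)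
    have hX0 : 0 ≤ γ X := by positivity
    have half : ∀ i, v ∈ e i → γ (X \ e i) ≤ 2 * γ X := by
      intro i _
      have h1 := chain (X ∩ e i) Finset.inter_subset_left
      rw [Finset.sdiff_inter_self_left] at h1
      have h2 : 1 / 2 ≤ β ^ (X ∩ e i).card :=
        hβD.trans (pow_le_pow_of_le_one hβ0.le hβ1
          ((Finset.card_le_card Finset.inter_subset_right).trans (he i)))
      have h3 : 0 ≤ γ (X \ e i) := by positivity
      nlinarith
    -- A function lost on adding `v` satisfies some bad event `i` with `v ∈ e i`. Keeping only the
    -- constraints supported off `e i` makes them independent of that event; by `half` this at most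
    -- doubles the count.
    have hsub : good X ⊆ good (insert v X) ∪
        (Finset.univ.filter fun i => v ∈ e i).biUnion fun i =>
          Finset.univ.filter fun f => (∀ i', e i' ⊆ X \ e i → ¬ Bad i' f) ∧ Bad i f := by
      intro f hf
      simp only [good, Finset.mem_filter, Finset.mem_univ, true_and, Finset.mem_union,
        Finset.mem_biUnion] at hf ⊢
      by_contra hcon
      push Not at hcon
      obtain ⟨⟨i, hi, hb⟩, hcon⟩ := hcon
      by_cases hvi : v ∈ e i
      · exact hcon i hvi (fun i' hi' => hf i' (hi'.trans Finset.sdiff_subset)) hb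
      · exact hf i ((Finset.subset_insert_iff_of_notMem hvi).1 hi) hb
    have hterm : ∀ i ∈ Finset.univ.filter (fun i => v ∈ e i),
        ((Finset.univ.filter fun f =>
          (∀ i', e i' ⊆ X \ e i → ¬ Bad i' f) ∧ Bad i f).card : ℝ) ≤ γ X / (2 * D ^ 2) := by
      intro i hi
      have h1 := card_filter_and_mul_card_le (e i)
        (fun f => ∀ i', e i' ⊆ X \ e i → ¬ Bad i' f) (Bad i)
        (fun f g hfg hf i' hi' hb => hf i' hi' (hBad i' g f
          (fun x hx => (hfg x (Finset.mem_sdiff.1 (hi' hx)).2).symm) hb)) (hBad i)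
      have h2 : ((Finset.univ.filter fun f =>
          (∀ i', e i' ⊆ X \ e i → ¬ Bad i' f) ∧ Bad i f).card : ℝ) * M ≤
          γ (X \ e i) * (Finset.univ.filter (Bad i)).card := by
        simp only [γ, good, hM]
        norm_cast
        convert h1
      have h3 := half i (Finset.mem_filter.1 hi).2
      have h4 := hcard i
      rw [le_div_iff₀ (by positivity)]
      have h5 : (0 : ℝ) ≤ (Finset.univ.filter (Bad i)).card := by positivity
      refine le_of_mul_le_mul_right ?_ hMpos
      calc _ = (((Finset.univ.filter fun f =>
          (∀ i', e i' ⊆ X \ e i → ¬ Bad i' f) ∧ Bad i f).card : ℝ) * M) * (2 * D ^ 2) := by ring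
        _ ≤ (2 * γ X * (Finset.univ.filter (Bad i)).card) * (2 * D ^ 2) := by
          exact mul_le_mul_of_nonneg_right
            (h2.trans (mul_le_mul_of_nonneg_right h3 h5)) (by positivity)
        _ = γ X * (4 * (D : ℝ) ^ 2 * (Finset.univ.filter (Bad i)).card) := by ring
        _ ≤ γ X * M := mul_le_mul_of_nonneg_left h4 hX0
    have hcount : γ X ≤ γ (insert v X) + D * (γ X / (2 * D ^ 2)) := by
      have h1 := (Finset.card_le_card hsub).trans (Finset.card_union_le _ _)
      have h2 : γ X ≤ γ (insert v X) + (((Finset.univ.filter fun i => v ∈ e i).biUnion fun i =>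
          Finset.univ.filter fun f =>
            (∀ i', e i' ⊆ X \ e i → ¬ Bad i' f) ∧ Bad i f).card : ℝ) := by
        simp only [γ]
        exact_mod_cast h1
      refine h2.trans (add_le_add_right ?_ _)
      have h3 : (((Finset.univ.filter fun i => v ∈ e i).biUnion fun i =>
          Finset.univ.filter fun f =>
            (∀ i', e i' ⊆ X \ e i → ¬ Bad i' f) ∧ Bad i f).card : ℝ) ≤
          ∑ i ∈ Finset.univ.filter (fun i => v ∈ e i), ((Finset.univ.filter fun f =>
            (∀ i', e i' ⊆ X \ e i → ¬ Bad i' f) ∧ Bad i f).card : ℝ) := by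
        exact_mod_cast Finset.card_biUnion_le
      refine (h3.trans (Finset.sum_le_card_nsmul _ _ _ hterm)).trans ?_
      rw [nsmul_eq_mul]
      refine mul_le_mul_of_nonneg_right ?_ (by positivity)
      exact_mod_cast hdeg v
    have : (D : ℝ) * (γ X / (2 * D ^ 2)) = 1 / (2 * D) * γ X := by field_simp
    rw [this] at hcount
    rw [hβ]; linarith
  have hpos : ∀ X : Finset V, 0 < γ X := by
    intro X
    induction X using Finset.induction_on with
    | empty =>
      -- An event with empty support is constant, and `hcard` prevents it from always holding.
      have : good ∅ = Finset.univ := by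
        refine Finset.filter_true_of_mem fun f _ i hi hb => ?_
        have hall : Finset.univ.filter (Bad i) = Finset.univ :=
          Finset.filter_true_of_mem fun g _ => hBad i f g
            (fun x hx => absurd (hi hx) (Finset.notMem_empty x)) hb
        have h := hcard i
        rw [hall, Finset.card_univ, ← hM] at h
        nlinarith [mul_le_mul_of_nonneg_right (one_le_pow₀ (n := 2) hD1) hMpos.le]
      change (0 : ℝ) < (good ∅).card
      rw [this, Finset.card_univ]
      exact hMpos
    | insert v X hv ih => exact (mul_pos hβ0 ih).trans_le (step _ X rfl v hv)
  have h := hpos Finset.univ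
  have h' : 0 < (good Finset.univ).card := by
    simp only [γ] at h
    exact_mod_cast h
  obtain ⟨f, hf⟩ := Finset.card_pos.1 h'
  exact ⟨f, fun i => (Finset.mem_filter.1 hf).2 i (Finset.subset_univ _)⟩

end LocalLemma

/-! ### Permutations that put any label last -/

section Codes

open Classical in
/-- The restriction of a uniformly random function to a `t`-tuple of distinct points is uniform. -/
theorem card_filter_comp_mul_card_le {V C T : Type*} [Fintype V] [Fintype C] [Fintype T]
    [DecidableEq T]
    (φ : T → V) (hφ : Function.Injective φ) (Q : (T → C) → Prop) :
    (Finset.univ.filter fun f : V → C => Q (f ∘ φ)).card * Fintype.card (T → C) ≤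
      (Finset.univ.filter Q).card * Fintype.card (V → C) := by
  rw [← Finset.card_univ, ← Finset.card_univ, ← Finset.card_product, ← Finset.card_product]
  -- Write `g` onto the points `φ` and keep the overwritten values as the first component.
  refine Finset.card_le_card_of_injOn
    (fun fg => (fg.1 ∘ φ, Function.extend φ fg.2 fg.1)) ?_ ?_
  · rintro ⟨f, g⟩ h
    simpa using h
  · rintro ⟨f, g⟩ - ⟨f', g'⟩ - h
    simp only [Prod.mk.injEq] at h
    have hg : g = g' := by
      have := congrArg (· ∘ φ) h.2
      simpa [Function.extend_comp hφ] using this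
    refine Prod.ext (funext fun x => ?_) hg
    by_cases hx : ∃ y, φ y = x
    · obtain ⟨y, rfl⟩ := hx
      exact congrFun h.1 y
    · have := congrFun h.2 x
      simpa [Function.extend_apply' _ _ _ hx] using this

-- Union bound over pairs: two given coordinates agree with probability at most `1 / Fintype.card
-- C`.
open Classical in
theorem card_filter_not_injective_mul_le {C T : Type*} [Fintype C] [Fintype T]
    [DecidableEq T] :
    (Finset.univ.filter fun g : T → C => ¬ Function.Injective g).card * Fintype.card C ≤
      Fintype.card T ^ 2 * Fintype.card (T → C) := by
  have hpair : ∀ i i' : T, i ≠ i' →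
      (Finset.univ.filter fun g : T → C => g i = g i').card * Fintype.card C ≤
        Fintype.card (T → C) := by
    intro i i' hii
    rw [← Finset.card_univ, ← Finset.card_univ, ← Finset.card_product]
    refine Finset.card_le_card_of_injOn (fun gx => Function.update gx.1 i gx.2) (by simp) ?_
    rintro ⟨g, x⟩ hg ⟨g', x'⟩ hg' h
    simp only [Finset.coe_product, Set.mem_prod, Finset.mem_coe, Finset.mem_filter,
      Finset.mem_univ, true_and, and_true] at hg hg'
    dsimp only at h
    have hx : x = x' := by simpa using congrFun h i
    have hne : ∀ k, k ≠ i → g k = g' k := fun k hk => by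
      simpa [Function.update_of_ne hk] using congrFun h k
    refine Prod.ext (funext fun k => ?_) hx
    by_cases hk : k = i
    · subst hk
      exact hg.trans ((hne i' hii.symm).trans hg'.symm)
    · exact hne k hk
  have hsub : (Finset.univ.filter fun g : T → C => ¬ Function.Injective g) ⊆
      (Finset.univ.filter fun q : T × T => q.1 ≠ q.2).biUnion fun q =>
        Finset.univ.filter fun g : T → C => g q.1 = g q.2 := by
    intro g hg
    simp only [Finset.mem_filter, Finset.mem_univ, true_and, Function.Injective, not_forall] at hg
    obtain ⟨a, b, hab, hne⟩ := hg
    simp only [Finset.mem_biUnion, Finset.mem_filter, Finset.mem_univ, true_and]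
    exact ⟨(a, b), hne, hab⟩
  calc _ ≤ (∑ q ∈ Finset.univ.filter (fun q : T × T => q.1 ≠ q.2),
        (Finset.univ.filter fun g : T → C => g q.1 = g q.2).card) * Fintype.card C := by
        gcongr
        exact (Finset.card_le_card hsub).trans Finset.card_biUnion_le
    _ = ∑ q ∈ Finset.univ.filter (fun q : T × T => q.1 ≠ q.2),
        (Finset.univ.filter fun g : T → C => g q.1 = g q.2).card * Fintype.card C :=
        Finset.sum_mul _ _ _
    _ ≤ ∑ q ∈ Finset.univ.filter (fun q : T × T => q.1 ≠ q.2), Fintype.card (T → C) :=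
        Finset.sum_le_sum fun q hq => hpair _ _ (Finset.mem_filter.1 hq).2
    _ ≤ _ := by
        rw [Finset.sum_const, smul_eq_mul]
        gcongr
        refine (Finset.card_filter_le _ _).trans ?_
        rw [Finset.card_univ, Fintype.card_prod, sq]

open Classical in
/-- A fixed element of `T` comes last in `T` in a proportion at least `1 / T.card` of all
permutations. -/
theorem factorial_le_card_mul_card_perm_last {m : ℕ} (T : Finset (Fin m)) (c : Fin m)
    (hc : c ∈ T) :
    m.factorial ≤ T.card *
      (Finset.univ.filter fun σ : Equiv.Perm (Fin m) => ∀ x ∈ T, x ≠ c → σ x < σ c).card := by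
  set A : Fin m → Finset (Equiv.Perm (Fin m)) := fun c =>
    Finset.univ.filter fun σ => ∀ x ∈ T, x ≠ c → σ x < σ c with hA
  have hmemA : ∀ c σ, σ ∈ A c ↔ ∀ x ∈ T, x ≠ c → σ x < σ c := fun c σ => by simp [hA]
  have hle : ∀ c' ∈ T, (A c').card ≤ (A c).card := by
    intro c' hc'
    -- By symmetry under the transposition of `c` and `c'`, all members of `T` come last equally
    -- often.
    refine Finset.card_le_card_of_injOn (fun σ => σ * Equiv.swap c c') ?_
      (fun σ _ τ _ h => mul_right_cancel h)
    intro σ hσ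
    rw [Finset.mem_coe, hmemA] at hσ ⊢
    intro x hx hxc
    rw [Equiv.Perm.mul_apply, Equiv.Perm.mul_apply, Equiv.swap_apply_left]
    apply hσ
    · rw [Equiv.swap_apply_def]
      split_ifs <;> assumption
    · intro h
      rw [Equiv.swap_apply_eq_iff, Equiv.swap_apply_right] at h
      exact hxc h
  have huniv : (Finset.univ : Finset (Equiv.Perm (Fin m))) ⊆ T.biUnion A := by
    intro σ _
    obtain ⟨c', hc', hmax⟩ := T.exists_max_image σ ⟨c, hc⟩
    refine Finset.mem_biUnion.2 ⟨c', hc', (hmemA _ _).2 fun x hx hxc => ?_⟩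
    exact lt_of_le_of_ne (hmax x hx) fun h => hxc (σ.injective h)
  calc m.factorial = (Finset.univ : Finset (Equiv.Perm (Fin m))).card := by
        rw [Finset.card_univ, Fintype.card_perm, Fintype.card_fin]
    _ ≤ (T.biUnion A).card := Finset.card_le_card huniv
    _ ≤ ∑ c' ∈ T, (A c').card := Finset.card_biUnion_le
    _ ≤ T.card * (A c).card := by
        rw [← smul_eq_mul]; exact Finset.sum_le_card_nsmul _ _ _ hle

/-- The tuple `g` of elements of `Fin m` is bad for the permutations `σ j` if there is an element
that comes after all other members of the tuple for no `j`. -/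
def BadTuple {m p : ℕ} {T : Type*} (σ : Fin p → Equiv.Perm (Fin m)) (g : T → Fin m) : Prop :=
  ∃ c, ∀ j, ∃ i, g i ≠ c ∧ σ j c ≤ σ j (g i)

-- The tuple together with `c` has at most `t + 1 ≤ s` values, so one permutation fails to put `c`
-- last with probability at most `1 - 1 / s`. The `p` permutations are independent, and the factor
-- `m` is the union bound over `c`.
open Classical in
theorem card_filter_badTuple_le {m p t s : ℕ} (hts : t < s) (g : Fin t → Fin m) :
    ((Finset.univ.filter fun σ : Fin p → Equiv.Perm (Fin m) => BadTuple σ g).card : ℝ) ≤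
      m * (1 - 1 / (s : ℝ)) ^ p * Fintype.card (Fin p → Equiv.Perm (Fin m)) := by
  have hs : (0 : ℝ) < s := by exact_mod_cast (Nat.zero_le t).trans_lt hts
  let B : Fin m → Finset (Equiv.Perm (Fin m)) := fun c =>
    Finset.univ.filter fun σ => ∃ i, g i ≠ c ∧ σ c ≤ σ (g i)
  have hB : ∀ c, ((B c).card : ℝ) ≤ (1 - 1 / (s : ℝ)) * m.factorial := by
    intro c
    set T : Finset (Fin m) := insert c (Finset.univ.image g) with hT
    have hTs : T.card ≤ s := by
      refine (Finset.card_insert_le _ _).trans ?_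
      have : (Finset.univ.image g).card ≤ t := Finset.card_image_le.trans (by simp)
      omega
    set A := Finset.univ.filter fun σ : Equiv.Perm (Fin m) => ∀ x ∈ T, x ≠ c → σ x < σ c with hA
    have h1 : m.factorial ≤ s * A.card :=
      (factorial_le_card_mul_card_perm_last T c (Finset.mem_insert_self _ _)).trans
        (Nat.mul_le_mul_right _ hTs)
    have hdisj : Disjoint (B c) A := by
      rw [Finset.disjoint_left]
      intro σ h2 h3
      obtain ⟨i, hi, hle⟩ := (Finset.mem_filter.1 h2).2
      exact absurd ((Finset.mem_filter.1 h3).2 (g i) (by simp [hT]) hi) (not_lt.2 hle)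
    have h2 : (B c).card + A.card ≤ m.factorial := by
      rw [← Finset.card_union_of_disjoint hdisj]
      refine (Finset.card_le_univ _).trans ?_
      rw [Fintype.card_perm, Fintype.card_fin]
    have h1' : (m.factorial : ℝ) ≤ s * A.card := by exact_mod_cast h1
    have h2' : ((B c).card : ℝ) + A.card ≤ m.factorial := by exact_mod_cast h2
    have h3 : (m.factorial : ℝ) / s ≤ A.card := by
      rw [div_le_iff₀ hs]; linarith
    have h4 : (1 - 1 / (s : ℝ)) * m.factorial = m.factorial - m.factorial / s := by ring
    linarith
  have hsub : (Finset.univ.filter fun σ : Fin p → Equiv.Perm (Fin m) => BadTuple σ g) ⊆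
      Finset.univ.biUnion fun c => Fintype.piFinset fun _ => B c := by
    intro σ hσ
    obtain ⟨c, hc⟩ := (Finset.mem_filter.1 hσ).2
    refine Finset.mem_biUnion.2 ⟨c, Finset.mem_univ _, Fintype.mem_piFinset.2 fun j => ?_⟩
    exact Finset.mem_filter.2 ⟨Finset.mem_univ _, hc j⟩
  have h1 : ((Finset.univ.filter fun σ : Fin p → Equiv.Perm (Fin m) => BadTuple σ g).card : ℝ) ≤
      ∑ c : Fin m, ((B c).card : ℝ) ^ p := by
    have h2 := (Finset.card_le_card hsub).trans Finset.card_biUnion_le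
    simp only [Fintype.card_piFinset, Finset.prod_const, Finset.card_univ, Fintype.card_fin] at h2
    exact_mod_cast h2
  refine h1.trans ((Finset.sum_le_card_nsmul _ _ _ fun c _ =>
    pow_le_pow_left₀ (Nat.cast_nonneg _) (hB c) p).trans (le_of_eq ?_))
  simp only [Finset.card_univ, Fintype.card_fin, nsmul_eq_mul, Fintype.card_pi, Finset.prod_const,
    Fintype.card_perm, Nat.cast_pow, mul_pow]
  ring

open Classical in
/-- There are permutations for which, for all `t < s`, only a small proportion of all `t`-tuples
is bad. -/
theorem exists_perms_card_badTuple_le (m p s : ℕ) (hm : 0 < m) :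
    ∃ σ : Fin p → Equiv.Perm (Fin m), ∀ t < s,
      ((Finset.univ.filter fun g : Fin t → Fin m => BadTuple σ g).card : ℝ) ≤
        s * m * (1 - 1 / (s : ℝ)) ^ p * m ^ t := by
  have hm' : (0 : ℝ) < m := by exact_mod_cast hm
  -- Averaging the sum of the proportions over all `t < s` yields one `σ` for every length at once,
  -- at the price of the factor `s`.
  let w : (Fin p → Equiv.Perm (Fin m)) → ℕ → ℝ := fun σ t =>
    ((Finset.univ.filter fun g : Fin t → Fin m => BadTuple σ g).card : ℝ) / m ^ t
  have hw : ∀ σ t, 0 ≤ w σ t := fun σ t => by positivity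
  have havg : ∀ t ∈ Finset.range s, ∑ σ, w σ t ≤
      m * (1 - 1 / (s : ℝ)) ^ p * Fintype.card (Fin p → Equiv.Perm (Fin m)) := by
    intro t ht
    have h1 : ∑ σ, w σ t = (∑ g : Fin t → Fin m,
        ((Finset.univ.filter fun σ : Fin p → Equiv.Perm (Fin m) => BadTuple σ g).card : ℝ)) /
          m ^ t := by
      simp only [w]
      rw [← Finset.sum_div]
      congr 1
      simp only [Finset.card_filter, Nat.cast_sum]
      exact Finset.sum_comm
    rw [h1, div_le_iff₀ (by positivity)]
    refine (Finset.sum_le_card_nsmul _ _ _ fun g _ =>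
      card_filter_badTuple_le (Finset.mem_range.1 ht) g).trans (le_of_eq ?_)
    simp only [Finset.card_univ, Fintype.card_pi, Finset.prod_const, Fintype.card_fin,
      nsmul_eq_mul, Nat.cast_pow]
    ring
  have htot : ∑ σ, ∑ t ∈ Finset.range s, w σ t ≤
      ∑ _σ : Fin p → Equiv.Perm (Fin m), s * m * (1 - 1 / (s : ℝ)) ^ p := by
    rw [Finset.sum_comm]
    refine (Finset.sum_le_card_nsmul _ _ _ havg).trans (le_of_eq ?_)
    simp only [Finset.card_range, Finset.sum_const, Finset.card_univ, nsmul_eq_mul]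
    ring
  obtain ⟨σ, -, hσ⟩ := Finset.exists_le_of_sum_le Finset.univ_nonempty htot
  refine ⟨σ, fun t ht => ?_⟩
  have h1 := (Finset.single_le_sum (f := w σ) (fun t _ => hw σ t) (Finset.mem_range.2 ht)).trans hσ
  rwa [div_le_iff₀ (by positivity)] at h1

end Codes

/-! ### Threshold graphs from rankings -/

section Threshold

/-- The graph in which `x` and `y` are not adjacent if both lie in `B`, or if one of them lies in
`B` and has rank at least that of the other one, outside `B`. -/
def rankGraph {V : Type*} (B : Set V) (r : V → ℕ) : SimpleGraph V where
  Adj x y := x ≠ y ∧ ¬ (x ∈ B ∧ y ∈ B) ∧ ¬ (x ∈ B ∧ y ∉ B ∧ r y ≤ r x) ∧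
    ¬ (y ∈ B ∧ x ∉ B ∧ r x ≤ r y)
  symm := ⟨fun _ _ h => ⟨h.1.symm, fun h' => h.2.1 h'.symm, h.2.2.2, h.2.2.1⟩⟩
  loopless := ⟨fun _ h => h.1 rfl⟩

/-- Weights outside `B` decay geometrically with the rank, with ratio `q < 1 / n`. A vertex of `B`
of rank `k` leaves room `n * q ^ (k + 1)` below the bound `t`: enough for `n` vertices of higher
rank, but less than the weight of a single one of rank at most `k`. Two vertices of `B` overshoot
`t`, and vertices outside `B` alone weigh at most `n`. -/
theorem rankGraph_isThreshold {V : Type*} [Finite V] (B : Set V) (r : V → ℕ) :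
    (rankGraph B r).IsThreshold := by
  classical
  have := Fintype.ofFinite V
  set n : ℕ := Fintype.card V with hn
  set q : ℝ := 1 / ((n : ℝ) + 1) with hq
  have hq0 : 0 < q := by positivity
  have hnq : n * q < 1 := by
    rw [hq, mul_one_div, div_lt_one (by positivity)]; linarith
  have hq1 : q ≤ 1 := by
    rw [hq, div_le_one (by positivity)]
    have : (0 : ℝ) ≤ n := Nat.cast_nonneg n
    linarith
  set t : ℝ := n + 2 with ht
  have hn0 : (0 : ℝ) ≤ n := Nat.cast_nonneg n
  have hqk : ∀ k, 0 < q ^ k := fun k => pow_pos hq0 k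
  have hqk1 : ∀ k, q ^ k ≤ 1 := fun k => pow_le_one₀ hq0.le hq1
  have hnqk : ∀ k, n * q ^ (k + 1) < q ^ k := fun k => by
    rw [pow_succ, mul_left_comm]
    exact mul_lt_of_lt_one_right (hqk k) hnq
  set a : V → ℝ := fun x => if x ∈ B then t - n * q ^ (r x + 1) else q ^ r x with ha
  have haB : ∀ x ∈ B, a x = t - n * q ^ (r x + 1) := fun x hx => by simp [ha, hx]
  have haB' : ∀ x ∉ B, a x = q ^ r x := fun x hx => by simp [ha, hx]
  have hlarge : ∀ x ∈ B, t - 1 < a x := fun x hx => by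
    rw [haB x hx]
    have := hnqk (r x)
    have := hqk1 (r x)
    linarith
  have ha0 : ∀ x, 0 ≤ a x := fun x => by
    by_cases hx : x ∈ B
    · have := hlarge x hx
      linarith
    · rw [haB' x hx]; exact (hqk _).le
  have hcard : ∀ S : Finset V, (S.card : ℝ) ≤ n := fun S => by
    exact_mod_cast Finset.card_le_univ S
  have hpair : ∀ S : Finset V, ∀ x ∈ S, ∀ y ∈ S, x ≠ y → a x + a y ≤ ∑ v ∈ S, a v := by
    intro S x hx y hy hxy
    rw [← Finset.sum_pair hxy]
    refine Finset.sum_le_sum_of_subset_of_nonneg ?_ fun v _ _ => ha0 v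
    intro v hv
    rcases Finset.mem_insert.1 hv with rfl | hv
    · exact hx
    · rw [Finset.mem_singleton.1 hv]; exact hy
  have hmixed : ∀ x ∈ B, ∀ y ∉ B, r y ≤ r x → t < a x + a y := by
    intro x hx y hy hxy
    rw [haB x hx, haB' y hy]
    have h1 := hnqk (r x)
    have h2 : q ^ r x ≤ q ^ r y := pow_le_pow_of_le_one hq0.le hq1 hxy
    linarith
  refine ⟨a, t, fun S => ⟨fun h x hx y hy hxy => ?_, fun h => ?_⟩⟩
  · have h1 := hpair S x hx y hy hxy
    refine ⟨hxy, ?_, ?_, ?_⟩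
    · rintro ⟨hxB, hyB⟩
      have := hlarge x hxB
      have := hlarge y hyB
      linarith
    · rintro ⟨hxB, hyB, hr⟩
      have := hmixed x hxB y hyB hr
      linarith
    · rintro ⟨hyB, hxB, hr⟩
      have := hmixed y hyB x hxB hr
      linarith
  · by_cases hS : ∃ x ∈ S, x ∈ B
    · obtain ⟨x, hxS, hxB⟩ := hS
      rw [← Finset.add_sum_erase S a hxS, haB x hxB]
      have h1 : ∀ y ∈ S.erase x, a y ≤ q ^ (r x + 1) := by
        intro y hy
        obtain ⟨hyx, hyS⟩ := Finset.mem_erase.1 hy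
        obtain ⟨-, h2, h3, -⟩ := h (Finset.mem_coe.2 hxS) (Finset.mem_coe.2 hyS) hyx.symm
        have hyB : y ∉ B := fun hyB => h2 ⟨hxB, hyB⟩
        rw [haB' y hyB]
        refine pow_le_pow_of_le_one hq0.le hq1 ?_
        by_contra hlt
        exact h3 ⟨hxB, hyB, by omega⟩
      have h2 := Finset.sum_le_card_nsmul _ _ _ h1
      rw [nsmul_eq_mul] at h2
      have h3 := mul_le_mul_of_nonneg_right (hcard (S.erase x)) (hqk (r x + 1)).le
      linarith
    · push Not at hS
      have h1 : ∀ y ∈ S, a y ≤ 1 := fun y hy => by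
        rw [haB' y (hS y hy)]; exact hqk1 _
      have h2 := Finset.sum_le_card_nsmul _ _ _ h1
      rw [nsmul_eq_mul, mul_one] at h2
      have := hcard S
      linarith

theorem SimpleGraph.thresholdDim_le_card {V ι : Type*} [Finite V] [Fintype ι] (G : SimpleGraph V)
    (H : ι → SimpleGraph V) (hH : ∀ i, (H i).IsThreshold) (hle : ∀ i, G ≤ H i)
    (hcov : ∀ x y, x ≠ y → ¬ G.Adj x y → ∃ i, ¬ (H i).Adj x y) :
    G.thresholdDim ≤ Fintype.card ι := by
  classical
  unfold SimpleGraph.thresholdDim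
  refine Nat.find_min' _ ⟨fun k => H ((Fintype.equivFin ι).symm k), fun k => hH _, ?_⟩
  rw [(Fintype.equivFin ι).symm.iInf_comp (g := H)]
  refine le_antisymm (le_iInf hle) fun x y h => ?_
  rw [SimpleGraph.iInf_adj] at h
  by_contra hn
  obtain ⟨i, hi⟩ := hcov x y h.2 hn
  exact hi (h.1 i)

end Threshold

/-! ### Proper colourings with sparse colour classes -/

section Coloring

open Classical in
/-- Greedy colouring. -/
theorem SimpleGraph.exists_coloring_of_card_neighbors_lt {V : Type*} [Fintype V]
    (G : SimpleGraph V) (s : ℕ) (hs : ∀ v, (Finset.univ.filter (G.Adj v)).card < s) :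
    ∃ f : V → Fin s, ∀ u v, G.Adj u v → f u ≠ f v := by
  by_cases hV : Nonempty V
  swap
  · exact ⟨fun v => absurd ⟨v⟩ hV, fun v => absurd ⟨v⟩ hV⟩
  obtain ⟨v₀⟩ := hV
  have : Nonempty (Fin s) := ⟨⟨0, (Nat.zero_le _).trans_lt (hs v₀)⟩⟩
  suffices h : ∀ X : Finset V, ∃ f : V → Fin s, ∀ u ∈ X, ∀ v ∈ X, G.Adj u v → f u ≠ f v by
    obtain ⟨f, hf⟩ := h Finset.univ
    exact ⟨f, fun u v => hf u (Finset.mem_univ _) v (Finset.mem_univ _)⟩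
  intro X
  induction X using Finset.induction_on with
  | empty => exact ⟨fun _ => Classical.arbitrary _, by simp⟩
  | insert x X hx ih =>
    obtain ⟨f, hf⟩ := ih
    obtain ⟨c, hc⟩ : ∃ c, c ∉ (Finset.univ.filter (G.Adj x)).image f := by
      by_contra! hall
      have h1 : (Finset.univ : Finset (Fin s)).card ≤ _ :=
        Finset.card_le_card fun c _ => hall c
      rw [Finset.card_univ, Fintype.card_fin] at h1
      exact absurd (h1.trans Finset.card_image_le) (not_le.2 (hs x))
    have hc' : ∀ v, G.Adj x v → f v ≠ c := fun v hv h =>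
      hc (Finset.mem_image.2 ⟨v, by simpa using hv, h⟩)
    have hne : ∀ v ∈ X, v ≠ x := fun v hv h => hx (h ▸ hv)
    refine ⟨Function.update f x c, fun u hu v hv huv => ?_⟩
    rcases Finset.mem_insert.1 hu with rfl | hu
    · rw [Function.update_self, Function.update_of_ne huv.ne']
      exact (hc' v huv).symm
    · rcases Finset.mem_insert.1 hv with rfl | hv
      · rw [Function.update_self, Function.update_of_ne huv.ne]
        exact hc' u huv.symm
      · rw [Function.update_of_ne (hne u hu), Function.update_of_ne (hne v hv)]
        exact hf u hu v hv huv

open Classical in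
/-- For a random colouring with `r` colours, the probability that some colour occurs `s` times in
a given set of at most `D` vertices. -/
theorem card_filter_exists_color_le {V : Type*} [Fintype V] (A : Finset V) (D r s : ℕ)
    (hA : A.card ≤ D) :
    (Finset.univ.filter fun f : V → Fin r =>
      ∃ i, s ≤ (A.filter fun x => f x = i).card).card * r ^ s ≤
        D.choose s * r * Fintype.card (V → Fin r) := by
  have hone : ∀ T : Finset V, T.card = s → ∀ i : Fin r,
      (Finset.univ.filter fun f : V → Fin r => ∀ x ∈ T, f x = i).card * r ^ s ≤
        Fintype.card (V → Fin r) := by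
    intro T hT i
    have h3 : Fintype.card (T → Fin r) = r ^ s := by simp [hT]
    have h1 : (Finset.univ.filter fun f : V → Fin r => ∀ x ∈ T, f x = i).card * r ^ s ≤
        (Finset.univ.filter fun g : T → Fin r => ∀ x, g x = i).card *
          Fintype.card (V → Fin r) := by
      have h := card_filter_comp_mul_card_le (C := Fin r) (fun x : T => (x : V))
        Subtype.val_injective (fun g => ∀ x, g x = i)
      rw [h3] at h
      convert h using 4
      simp
    have h2 : (Finset.univ.filter fun g : T → Fin r => ∀ x, g x = i).card ≤ 1 := by
      rw [Finset.card_le_one]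
      intro g hg g' hg'
      ext x
      rw [(Finset.mem_filter.1 hg).2 x, (Finset.mem_filter.1 hg').2 x]
    refine h1.trans ?_
    calc _ ≤ 1 * Fintype.card (V → Fin r) := Nat.mul_le_mul_right _ h2
      _ = _ := one_mul _
  have hsub : (Finset.univ.filter fun f : V → Fin r =>
      ∃ i, s ≤ (A.filter fun x => f x = i).card) ⊆
      (A.powersetCard s ×ˢ (Finset.univ : Finset (Fin r))).biUnion fun q =>
        Finset.univ.filter fun f : V → Fin r => ∀ x ∈ q.1, f x = q.2 := by
    intro f hf
    obtain ⟨i, hi⟩ := (Finset.mem_filter.1 hf).2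
    obtain ⟨T, hTsub, hT⟩ := Finset.exists_subset_card_eq hi
    refine Finset.mem_biUnion.2 ⟨(T, i), ?_, ?_⟩
    · exact Finset.mem_product.2 ⟨Finset.mem_powersetCard.2
        ⟨hTsub.trans (Finset.filter_subset _ _), hT⟩, Finset.mem_univ _⟩
    · exact Finset.mem_filter.2 ⟨Finset.mem_univ _, fun x hx => (Finset.mem_filter.1 (hTsub hx)).2⟩
  calc _ ≤ (∑ q ∈ A.powersetCard s ×ˢ (Finset.univ : Finset (Fin r)),
        (Finset.univ.filter fun f : V → Fin r => ∀ x ∈ q.1, f x = q.2).card) * r ^ s := by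
        gcongr
        exact (Finset.card_le_card hsub).trans Finset.card_biUnion_le
    _ = ∑ q ∈ A.powersetCard s ×ˢ (Finset.univ : Finset (Fin r)),
        (Finset.univ.filter fun f : V → Fin r => ∀ x ∈ q.1, f x = q.2).card * r ^ s :=
        Finset.sum_mul _ _ _
    _ ≤ ∑ q ∈ A.powersetCard s ×ˢ (Finset.univ : Finset (Fin r)), Fintype.card (V → Fin r) :=
        Finset.sum_le_sum fun q hq =>
          hone _ (Finset.mem_powersetCard.1 (Finset.mem_product.1 hq).1).2 _
    _ ≤ _ := by
        rw [Finset.sum_const, smul_eq_mul, Finset.card_product, Finset.card_powersetCard,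
          Finset.card_univ, Fintype.card_fin]
        gcongr

open Classical in
/-- Under a numerical condition, a graph of maximum degree at most `D` has a proper colouring with
`r * s` colours in which every vertex has fewer than `s` neighbours of each colour. -/
theorem SimpleGraph.exists_sparse_coloring {V : Type*} [Fintype V] (G : SimpleGraph V)
    (D r s : ℕ) (hD : 0 < D) (hr : 0 < r) (hdeg : ∀ v, (Finset.univ.filter (G.Adj v)).card ≤ D)
    (hnum : 4 * (D : ℝ) ^ 2 * (D.choose s * r) ≤ r ^ s) :
    ∃ f : V → Fin r × Fin s, (∀ u v, G.Adj u v → f u ≠ f v) ∧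
      ∀ v c, (Finset.univ.filter fun w => G.Adj v w ∧ f w = c).card < s := by
  have : Nonempty (Fin r) := ⟨⟨0, hr⟩⟩
  obtain ⟨f, hf⟩ := exists_forall_not_of_card_le (C := Fin r) D hD
    (fun v => Finset.univ.filter (G.Adj v)) hdeg
    (fun v => by simpa [G.adj_comm] using hdeg v)
    (fun v f => ∃ i, s ≤ ((Finset.univ.filter (G.Adj v)).filter fun x => f x = i).card)
    (by
      rintro v f g hfg ⟨i, hi⟩
      refine ⟨i, hi.trans (le_of_eq ?_)⟩
      congr 1
      exact Finset.filter_congr fun x hx => by rw [hfg x hx])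
    (fun v => by
      have h1 := card_filter_exists_color_le (Finset.univ.filter (G.Adj v)) D r s (hdeg v)
      have h2 : ((Finset.univ.filter fun f : V → Fin r => ∃ i, s ≤
          ((Finset.univ.filter (G.Adj v)).filter fun x => f x = i).card).card : ℝ) * r ^ s ≤
          D.choose s * r * (Fintype.card (V → Fin r) : ℕ) := by exact_mod_cast h1
      have hrs : (0 : ℝ) < r ^ s := by positivity
      have h3 : 4 * (D : ℝ) ^ 2 * ((Finset.univ.filter fun f : V → Fin r => ∃ i, s ≤
            ((Finset.univ.filter (G.Adj v)).filter fun x => f x = i).card).card : ℝ) ≤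
          (Fintype.card (V → Fin r) : ℕ) := by
        refine le_of_mul_le_mul_right ?_ hrs
        calc _ = 4 * (D : ℝ) ^ 2 * (((Finset.univ.filter fun f : V → Fin r => ∃ i, s ≤
              ((Finset.univ.filter (G.Adj v)).filter fun x => f x = i).card).card : ℝ) *
                r ^ s) := by ring
          _ ≤ 4 * (D : ℝ) ^ 2 * (D.choose s * r * (Fintype.card (V → Fin r) : ℕ)) := by gcongr
          _ = (4 * (D : ℝ) ^ 2 * (D.choose s * r)) * (Fintype.card (V → Fin r) : ℕ) := by ring
          _ ≤ r ^ s * (Fintype.card (V → Fin r) : ℕ) := by gcongr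
          _ = _ := mul_comm _ _
      convert h3)
  push Not at hf
  simp only [Finset.filter_filter] at hf
  -- The monochromatic edges form a graph of degree less than `s`, so `s` further colours make the
  -- colouring proper.
  let G' : SimpleGraph V :=
    { Adj := fun u v => G.Adj u v ∧ f u = f v
      symm := ⟨fun _ _ h => ⟨h.1.symm, h.2.symm⟩⟩
      loopless := ⟨fun _ h => h.1.ne rfl⟩ }
  obtain ⟨g, hg⟩ := G'.exists_coloring_of_card_neighbors_lt s fun v => by
    refine (Finset.card_le_card ?_).trans_lt (hf v (f v))
    intro w hw
    simp only [Finset.mem_filter, Finset.mem_univ, true_and] at hw ⊢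
    exact ⟨hw.1, hw.2.symm⟩
  refine ⟨fun v => (f v, g v), fun u v huv h => ?_, fun v c => ?_⟩
  · rw [Prod.mk.injEq] at h
    exact hg u v ⟨huv, h.1⟩ h.2
  · refine (Finset.card_le_card ?_).trans_lt (hf v c.1)
    intro w hw
    have h := (Finset.mem_filter.1 hw).2
    exact Finset.mem_filter.2 ⟨Finset.mem_univ _, h.1, by rw [← h.2]⟩

end Coloring

/-! ### Covering the non-edges -/

section Bound

-- Local lemma for a random labelling: the event at `v` is that the labels on its neighbours in `B`
-- repeat or form a bad tuple, of probability at most `δ + s ^ 2 / m`.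
open Classical in
theorem SimpleGraph.exists_code_coloring {V : Type*} [Fintype V] (G : SimpleGraph V)
    {D s m p : ℕ} (hD : 0 < D) (hm : 0 < m) (hdeg : ∀ v, (Finset.univ.filter (G.Adj v)).card ≤ D)
    (B : Set V) (hB : ∀ v, (Finset.univ.filter fun w => G.Adj v w ∧ w ∈ B).card < s)
    (σ : Fin p → Equiv.Perm (Fin m)) (δ : ℝ)
    (hσ : ∀ t < s, ((Finset.univ.filter fun g : Fin t → Fin m => BadTuple σ g).card : ℝ) ≤
      δ * m ^ t)
    (hnum : 4 * (D : ℝ) ^ 2 * (δ + s ^ 2 / m) ≤ 1) :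
    ∃ f : V → Fin m, ∀ v,
      (∀ x y, G.Adj v x → x ∈ B → G.Adj v y → y ∈ B → f x = f y → x = y) ∧
      ∀ c, ∃ j, ∀ x, G.Adj v x → x ∈ B → f x ≠ c → σ j (f x) < σ j c := by
  have : Nonempty (Fin m) := ⟨⟨0, hm⟩⟩
  have hm' : (0 : ℝ) < m := by exact_mod_cast hm
  set e : V → Finset V := fun v => Finset.univ.filter fun w => G.Adj v w ∧ w ∈ B with he
  let φ : ∀ v, Fin (e v).card → V := fun v i => ((e v).equivFin.symm i : V)
  have hφ : ∀ v, Function.Injective (φ v) := fun v =>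
    Subtype.val_injective.comp (e v).equivFin.symm.injective
  have hφe : ∀ v i, φ v i ∈ e v := fun v i => ((e v).equivFin.symm i).2
  have hφs : ∀ v x, x ∈ e v → ∃ i, φ v i = x := fun v x hx =>
    ⟨(e v).equivFin ⟨x, hx⟩, by simp [φ]⟩
  let Q : ∀ t : ℕ, (Fin t → Fin m) → Prop := fun t g => ¬ Function.Injective g ∨ BadTuple σ g
  have hQ : ∀ t < s, ((Finset.univ.filter (Q t)).card : ℝ) ≤ (δ + s ^ 2 / m) * m ^ t := by
    intro t ht
    have h1 := card_filter_not_injective_mul_le (C := Fin m) (T := Fin t)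
    simp only [Fintype.card_fin, Fintype.card_pi, Finset.prod_const, Finset.card_univ] at h1
    have h2 : ((Finset.univ.filter fun g : Fin t → Fin m => ¬ Function.Injective g).card : ℝ) * m ≤
        t ^ 2 * m ^ t := by
      norm_cast
      convert h1
    have h3 : ((Finset.univ.filter fun g : Fin t → Fin m => ¬ Function.Injective g).card : ℝ) ≤
        s ^ 2 / m * m ^ t := by
      rw [div_mul_eq_mul_div, le_div_iff₀ hm']
      refine h2.trans ?_
      gcongr
    have h4 : (Finset.univ.filter (Q t)).card ≤
        (Finset.univ.filter fun g : Fin t → Fin m => ¬ Function.Injective g).card +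
          (Finset.univ.filter fun g : Fin t → Fin m => BadTuple σ g).card := by
      refine le_trans (Finset.card_le_card fun g hg => ?_) (Finset.card_union_le _ _)
      simpa [Q] using hg
    have h5 : ((Finset.univ.filter (Q t)).card : ℝ) ≤ _ := Nat.cast_le.2 h4
    rw [Nat.cast_add] at h5
    have h6 := hσ t ht
    linarith
  obtain ⟨f, hf⟩ := exists_forall_not_of_card_le (C := Fin m) D hD e
    (fun v => (Finset.card_le_card fun w hw => by
      simp only [he, Finset.mem_filter, Finset.mem_univ, true_and] at hw ⊢
      exact hw.1).trans (hdeg v))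
    (fun v => (Finset.card_le_card fun w hw => by
      simp only [he, Finset.mem_filter, Finset.mem_univ, true_and] at hw ⊢
      exact hw.1.symm).trans (hdeg v))
    (fun v f => Q (e v).card (f ∘ φ v))
    (fun v f g hfg hf => by
      have : f ∘ φ v = g ∘ φ v := funext fun i => hfg _ (hφe v i)
      rwa [← this])
    (fun v => by
      have h1 := card_filter_comp_mul_card_le (C := Fin m) (φ v) (hφ v) (Q (e v).card)
      have h2 : Fintype.card (Fin (e v).card → Fin m) = m ^ (e v).card := by simp
      rw [h2] at h1
      have h3 : ((Finset.univ.filter fun f : V → Fin m => Q (e v).card (f ∘ φ v)).card : ℝ) *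
          m ^ (e v).card ≤ (Finset.univ.filter (Q (e v).card)).card *
            (Fintype.card (V → Fin m) : ℕ) := by
        norm_cast
        convert h1
      have h4 := hQ (e v).card (hB v)
      have h5 : (0 : ℝ) < m ^ (e v).card := by positivity
      have h6 : 4 * (D : ℝ) ^ 2 *
          (Finset.univ.filter fun f : V → Fin m => Q (e v).card (f ∘ φ v)).card ≤
            (Fintype.card (V → Fin m) : ℕ) := by
        refine le_of_mul_le_mul_right ?_ h5
        calc _ = 4 * (D : ℝ) ^ 2 *
              (((Finset.univ.filter fun f : V → Fin m => Q (e v).card (f ∘ φ v)).card : ℝ) *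
                m ^ (e v).card) := by ring
          _ ≤ 4 * (D : ℝ) ^ 2 * ((δ + s ^ 2 / m) * m ^ (e v).card *
              (Fintype.card (V → Fin m) : ℕ)) := by
              exact mul_le_mul_of_nonneg_left
                (h3.trans (mul_le_mul_of_nonneg_right h4 (Nat.cast_nonneg _))) (by positivity)
          _ = (4 * (D : ℝ) ^ 2 * (δ + s ^ 2 / m)) *
              ((Fintype.card (V → Fin m) : ℕ) * m ^ (e v).card) := by ring
          _ ≤ 1 * ((Fintype.card (V → Fin m) : ℕ) * m ^ (e v).card) := by gcongr
          _ = _ := one_mul _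
      convert h6)
  refine ⟨f, fun v => ?_⟩
  have hv := hf v
  simp only [Q, not_or, not_not] at hv
  have hmem : ∀ x, G.Adj v x → x ∈ B → x ∈ e v := fun x h1 h2 => by simp [he, h1, h2]
  constructor
  · intro x y hx hxB hy hyB hxy
    obtain ⟨i, rfl⟩ := hφs v x (hmem x hx hxB)
    obtain ⟨i', rfl⟩ := hφs v y (hmem y hy hyB)
    rw [hv.1 hxy]
  · intro c
    have h := hv.2
    unfold BadTuple at h
    push Not at h
    obtain ⟨j, hj⟩ := h c
    refine ⟨j, fun x hx hxB hxc => ?_⟩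
    obtain ⟨i, rfl⟩ := hφs v x (hmem x hx hxB)
    exact hj i hxc

/-- The non-edges of `G` that meet an independent set `B` are covered by the non-edges of `2 * p`
threshold graphs that contain `G`. -/
theorem SimpleGraph.exists_threshold_cover {V : Type*} [Fintype V] (G : SimpleGraph V)
    {m p : ℕ} (B : Set V) (hind : ∀ x ∈ B, ∀ y ∈ B, ¬ G.Adj x y)
    (σ : Fin p → Equiv.Perm (Fin m)) (f : V → Fin m)
    (hinj : ∀ v x y, G.Adj v x → x ∈ B → G.Adj v y → y ∈ B → f x = f y → x = y)
    (hlast : ∀ v c, ∃ j, ∀ x, G.Adj v x → x ∈ B → f x ≠ c → σ j (f x) < σ j c)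
    (hp : 0 < p) :
    ∃ H : Fin p × Bool → SimpleGraph V, (∀ i, (H i).IsThreshold) ∧ (∀ i, G ≤ H i) ∧
      ∀ x y, x ≠ y → ¬ G.Adj x y → y ∈ B → ∃ i, ¬ (H i).Adj x y := by
  classical
  set n := Fintype.card V with hn
  let ord : V → ℕ := fun v => (Fintype.equivFin V v : ℕ)
  have hord : ∀ v, ord v < n := fun v => (Fintype.equivFin V v).2
  have hordinj : ∀ u v, ord u = ord v → u = v := fun u v h =>
    (Fintype.equivFin V).injective (Fin.ext h)
  -- Lexicographic rank: the permuted label first, then the vertex order or its reverse, which stays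
  -- below `n`.
  let ρ : Fin p × Bool → V → ℕ := fun i v =>
    (σ i.1 (f v) : ℕ) * n + if i.2 then ord v else n - 1 - ord v
  -- The `+ 1` keeps the edges of `G`. A vertex without neighbours in `B` gets rank `0`, hence is
  -- non-adjacent to all of `B`.
  let r : Fin p × Bool → V → ℕ := fun i v =>
    if v ∈ B then ρ i v else (Finset.univ.filter fun w => G.Adj v w ∧ w ∈ B).sup fun w => ρ i w + 1
  have hlt : ∀ (i : Fin p × Bool) v, (if i.2 then ord v else n - 1 - ord v : ℕ) < n := by
    rintro ⟨j, b⟩ v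
    have := hord v
    cases b <;> simp <;> omega
  have hρ : ∀ i u v, σ i.1 (f u) < σ i.1 (f v) → ρ i u < ρ i v := by
    intro i u v h
    have h1 : (σ i.1 (f u) : ℕ) + 1 ≤ σ i.1 (f v) := h
    have h2 := Nat.mul_le_mul_right n h1
    have h3 := hlt i u
    simp only [ρ]
    rw [add_mul, one_mul] at h2
    omega
  refine ⟨fun i => rankGraph B (r i), fun i => rankGraph_isThreshold _ _, ?_, ?_⟩
  · have key : ∀ i x y, G.Adj x y → ¬ (x ∈ B ∧ y ∉ B ∧ r i y ≤ r i x) := by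
      rintro i x y hxy ⟨hx, hy, h⟩
      simp only [r, if_pos hx, if_neg hy] at h
      have h1 := Finset.le_sup (s := Finset.univ.filter fun w => G.Adj y w ∧ w ∈ B)
        (f := fun w => ρ i w + 1) (b := x) (by simp [hxy.symm, hx])
      have := h1.trans h
      simp at this
    exact fun i x y hxy => ⟨hxy.ne, fun h => hind x h.1 y h.2 hxy, key i x y hxy,
      key i y x hxy.symm⟩
  · intro x y hxy hadj hy
    by_cases hx : x ∈ B
    · exact ⟨(⟨0, hp⟩, true), fun h => h.2.1 ⟨hx, hy⟩⟩
    obtain ⟨j, hj⟩ := hlast x (f y)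
    obtain ⟨b, hb⟩ : ∃ b : Bool, ∀ z, G.Adj x z → z ∈ B → f z = f y → ρ (j, b) z < ρ (j, b) y := by
      by_cases hz : ∃ z, G.Adj x z ∧ z ∈ B ∧ f z = f y
      · obtain ⟨z, hz, hzB, hzy⟩ := hz
        have hne : ord z ≠ ord y := fun h => hadj (hordinj _ _ h ▸ hz)
        -- By `hinj`, `z` is the only neighbour of `x` in `B` sharing the label of `y`; choose the
        -- direction that puts it before `y`.
        refine ⟨decide (ord z < ord y), fun w hw hwB hwy => ?_⟩
        obtain rfl := hinj x z w hz hzB hw hwB (hzy.trans hwy.symm)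
        have := hord z
        have := hord y
        simp only [ρ, hzy, decide_eq_true_eq]
        split_ifs <;> omega
      · exact ⟨true, fun z h1 h2 h3 => absurd ⟨z, h1, h2, h3⟩ hz⟩
    refine ⟨(j, b), fun h => h.2.2.2 ⟨hy, hx, ?_⟩⟩
    simp only [r, if_pos hy, if_neg hx]
    refine Finset.sup_le fun z hz => ?_
    obtain ⟨hz, hzB⟩ := (Finset.mem_filter.1 hz).2
    by_cases hzy : f z = f y
    · exact hb z hz hzB hzy
    · exact hρ (j, b) z y (hj z hz hzB hzy)

-- There are `r * s` colour classes with `2 * p` threshold graphs each; a non-edge `xy` is covered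
-- by the graphs for the class of `y`.
open Classical in
theorem SimpleGraph.thresholdDim_le_of_parameters {V : Type*} [Fintype V] (G : SimpleGraph V)
    {D r s m p : ℕ} (hD : 0 < D) (hr : 0 < r) (hm : 0 < m) (hp : 0 < p)
    (hdeg : ∀ v, (Finset.univ.filter (G.Adj v)).card ≤ D)
    (h₁ : 4 * (D : ℝ) ^ 2 * (D.choose s * r) ≤ r ^ s)
    (h₂ : 4 * (D : ℝ) ^ 2 * (s * m * (1 - 1 / (s : ℝ)) ^ p + s ^ 2 / m) ≤ 1) :
    G.thresholdDim ≤ r * s * (p * 2) := by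
  obtain ⟨k, hk, hks⟩ := G.exists_sparse_coloring D r s hD hr hdeg h₁
  obtain ⟨σ, hσ⟩ := exists_perms_card_badTuple_le m p s hm
  have hclass : ∀ c, ∃ H : Fin p × Bool → SimpleGraph V, (∀ i, (H i).IsThreshold) ∧
      (∀ i, G ≤ H i) ∧ ∀ x y, x ≠ y → ¬ G.Adj x y → k y = c → ∃ i, ¬ (H i).Adj x y := by
    intro c
    obtain ⟨f, hf⟩ := G.exists_code_coloring hD hm hdeg {v | k v = c}
      (fun v => by simpa using hks v c) σ _ hσ h₂
    exact G.exists_threshold_cover {v | k v = c}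
      (fun x hx y hy hxy => hk x y hxy (hx.trans hy.symm)) σ f
      (fun v => (hf v).1) (fun v => (hf v).2) hp
  choose H hH hle hcov using hclass
  refine (G.thresholdDim_le_card (fun q : (Fin r × Fin s) × (Fin p × Bool) => H q.1 q.2)
    (fun q => hH _ _) (fun q => hle _ _) fun x y hxy hadj => ?_).trans (by simp)
  obtain ⟨i, hi⟩ := hcov (k y) x y hxy hadj rfl
  exact ⟨(k y, i), hi⟩

end Bound

/-! ### Choice of parameters and final estimates -/

section Numerics

theorem choose_le_pow_three_mul_div (D s : ℕ) (hs : 0 < s) :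
    (D.choose s : ℝ) ≤ (3 * D / s) ^ s := by
  have hs' : (0 : ℝ) < s := by exact_mod_cast hs
  have h1 : (D.choose s : ℝ) ≤ (D : ℝ) ^ s / s.factorial := Nat.choose_le_pow_div s D
  have h2 : (s : ℝ) ^ s / s.factorial ≤ 3 ^ s := by
    refine (Real.pow_div_factorial_le_exp (s : ℝ) hs'.le s).trans ?_
    rw [← Real.exp_one_pow]
    exact pow_le_pow_left₀ (Real.exp_pos _).le (Real.exp_one_lt_d9.le.trans (by norm_num)) _
  have hf : (0 : ℝ) < s.factorial := by exact_mod_cast Nat.factorial_pos s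
  rw [div_le_iff₀ hf] at h2
  refine h1.trans ?_
  rw [div_le_iff₀ hf, div_pow, mul_pow, div_mul_eq_mul_div, le_div_iff₀ (by positivity)]
  calc (D : ℝ) ^ s * s ^ s ≤ D ^ s * (3 ^ s * s.factorial) := by gcongr
    _ = _ := by ring

-- With `l` just above the binary logarithm, `s = 4 * l` gives `2 ^ s ≥ D ^ 4`, and `r ≥ 6 * D / s`
-- gains this factor over the bound `(3 * D / s) ^ s` for the binomial coefficient. Taking `m = D ^
-- 5` makes repetitions rare, and `p = 10 * s * l` makes `(1 - 1 / s) ^ p` at most `D ^ (-10)`. The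
-- constant is `7 * 2 * 10 * 4 = 560`.
open Classical in
theorem SimpleGraph.thresholdDim_le_mul_natLog_sq {V : Type*} [Fintype V] (G : SimpleGraph V)
    {D : ℕ} (hD : 32 ≤ D) (hdeg : ∀ v, (Finset.univ.filter (G.Adj v)).card ≤ D) :
    G.thresholdDim ≤ 560 * D * (Nat.log 2 D + 1) ^ 2 := by
  set l := Nat.log 2 D + 1 with hl
  have hDl : D < 2 ^ l := Nat.lt_pow_succ_log_self (by norm_num) D
  have hl6 : 6 ≤ l := by
    have : 5 ≤ Nat.log 2 D := Nat.le_log_of_pow_le (by norm_num) (by norm_num; exact hD)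
    omega
  have hlD : 4 * l ≤ D := by
    have h1 : 2 ^ Nat.log 2 D ≤ D := Nat.pow_log_le_self 2 (by omega)
    have h2 : ∀ k, 5 ≤ k → 4 * (k + 1) ≤ 2 ^ k := by
      intro k hk
      induction k, hk using Nat.le_induction with
      | base => norm_num
      | succ k hk ih => rw [pow_succ]; omega
    exact (h2 _ (by omega)).trans h1
  set s := 4 * l with hs
  set r := 6 * D / s + 1 with hr
  have hs0 : 0 < s := by omega
  have hs' : (0 : ℝ) < s := by exact_mod_cast hs0
  have hD' : (32 : ℝ) ≤ D := by exact_mod_cast hD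
  have hsD : (s : ℝ) ≤ D := by exact_mod_cast hlD
  have hr0 : 0 < r := Nat.succ_pos _
  have hrD : r ≤ D := by
    -- Here `24` is the least possible `s`, because `l ≥ 6`.
    have : 6 * D / s ≤ 6 * D / 24 := Nat.div_le_div_left (by omega) (by norm_num)
    omega
  have hrs : r * s ≤ 7 * D := by
    have := Nat.div_mul_le_self (6 * D) s
    rw [hr, add_mul, one_mul]
    omega
  have hDl' : (D : ℝ) ≤ 2 ^ l := by exact_mod_cast hDl.le
  have h₁ : 4 * (D : ℝ) ^ 2 * (D.choose s * r) ≤ r ^ s := by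
    have hr6 : 6 * (D : ℝ) / s ≤ r := by
      have := Nat.lt_succ_floor (6 * (D : ℝ) / s)
      have h := Nat.floor_div_eq_div (K := ℝ) (6 * D) s
      push_cast at h
      rw [h] at this
      exact this.le
    have h2s : (D : ℝ) ^ 4 ≤ 2 ^ s := by
      calc (D : ℝ) ^ 4 ≤ (2 ^ l) ^ 4 := by gcongr
        _ = 2 ^ s := by rw [← pow_mul, hs, mul_comm]
    have hrD' : (r : ℝ) ≤ D := by exact_mod_cast hrD
    calc 4 * (D : ℝ) ^ 2 * (D.choose s * r)
        ≤ D * (D : ℝ) ^ 2 * ((3 * D / s) ^ s * D) := by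
          gcongr
          · linarith
          · exact choose_le_pow_three_mul_div D s hs0
      _ = (D : ℝ) ^ 4 * (3 * D / s) ^ s := by ring
      _ ≤ 2 ^ s * (3 * D / s) ^ s := by gcongr
      _ = (6 * D / s) ^ s := by rw [← mul_pow]; congr 1; ring
      _ ≤ r ^ s := by gcongr
  have h₂ : 4 * (D : ℝ) ^ 2 * (s * (D ^ 5 : ℕ) * (1 - 1 / (s : ℝ)) ^ (10 * s * l) +
      s ^ 2 / (D ^ 5 : ℕ)) ≤ 1 := by
    have hs1 : (1 : ℝ) ≤ s := by exact_mod_cast hs0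
    have hb : (1 - 1 / (s : ℝ)) ^ s ≤ 1 / 2 := by
      have h1 : 1 - 1 / (s : ℝ) ≤ Real.exp (-(1 / s)) := by
        have := Real.add_one_le_exp (-(1 / (s : ℝ)))
        linarith
      have h0 : 0 ≤ 1 - 1 / (s : ℝ) := by
        rw [sub_nonneg, div_le_one hs']; exact hs1
      calc (1 - 1 / (s : ℝ)) ^ s ≤ Real.exp (-(1 / s)) ^ s := pow_le_pow_left₀ h0 h1 s
        _ = Real.exp (-1) := by
          rw [← Real.exp_nat_mul]; congr 1; field_simp
        _ ≤ 1 / 2 := by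
          rw [Real.exp_neg, one_div]
          refine inv_anti₀ (by norm_num) ?_
          have := Real.add_one_le_exp (1 : ℝ)
          linarith
    have hb0 : 0 ≤ (1 - 1 / (s : ℝ)) ^ s := by
      refine pow_nonneg ?_ _
      rw [sub_nonneg, div_le_one hs']; exact hs1
    have hp0 : 0 ≤ (1 - 1 / (s : ℝ)) ^ (10 * s * l) := by
      rw [mul_comm 10, mul_assoc, pow_mul]
      exact pow_nonneg hb0 _
    have hp : (1 - 1 / (s : ℝ)) ^ (10 * s * l) ≤ 1 / (D : ℝ) ^ 10 := by
      calc (1 - 1 / (s : ℝ)) ^ (10 * s * l) = ((1 - 1 / (s : ℝ)) ^ s) ^ (10 * l) := by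
            rw [← pow_mul]; congr 1; ring
        _ ≤ (1 / 2) ^ (10 * l) := pow_le_pow_left₀ hb0 hb _
        _ = 1 / (2 ^ l) ^ 10 := by rw [div_pow, one_pow, ← pow_mul, mul_comm]
        _ ≤ 1 / (D : ℝ) ^ 10 := by gcongr
    push_cast
    calc 4 * (D : ℝ) ^ 2 * (s * (D : ℝ) ^ 5 * (1 - 1 / (s : ℝ)) ^ (10 * s * l) +
          s ^ 2 / (D : ℝ) ^ 5)
        ≤ 4 * (D : ℝ) ^ 2 * (D * (D : ℝ) ^ 5 * (1 / (D : ℝ) ^ 10) + D ^ 2 / (D : ℝ) ^ 5) := by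
          gcongr
      _ = 4 / (D : ℝ) ^ 2 + 4 / D := by field_simp
      _ ≤ 4 / 32 ^ 2 + 4 / 32 := by gcongr
      _ ≤ 1 := by norm_num
  have h := G.thresholdDim_le_of_parameters (r := r) (s := s) (m := D ^ 5) (p := 10 * s * l)
    (by omega) hr0 (by positivity) (by positivity) hdeg h₁ h₂
  refine h.trans ?_
  calc r * s * (10 * s * l * 2) ≤ 7 * D * (10 * s * l * 2) := Nat.mul_le_mul_right _ hrs
    _ = 560 * D * l ^ 2 := by rw [hs]; ring

open Classical in
/-- Graphs of maximum degree at most `D` have threshold dimension `O(D (log D) ^ 2)`. -/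
theorem SimpleGraph.thresholdDim_le_mul_log_sq {V : Type*} [Fintype V] (G : SimpleGraph V)
    {D : ℕ} (hD : 32 ≤ D) (hdeg : ∀ v, (Finset.univ.filter (G.Adj v)).card ≤ D) :
    (G.thresholdDim : ℝ) ≤ 5040 * D * Real.log D ^ 2 := by
  have hD' : (32 : ℝ) ≤ D := by exact_mod_cast hD
  have hlog1 : 1 ≤ Real.log D := by
    rw [Real.le_log_iff_exp_le (by linarith)]
    exact Real.exp_one_lt_d9.le.trans (by linarith)
  have hl : (Nat.log 2 D : ℝ) ≤ 2 * Real.log D := by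
    have h1 : ((2 : ℝ) ^ Nat.log 2 D) ≤ D := by
      exact_mod_cast Nat.pow_log_le_self 2 (by omega)
    have h2 := Real.log_le_log (by positivity) h1
    rw [Real.log_pow] at h2
    have h3 := Real.log_two_gt_d9
    have h4 : (0 : ℝ) ≤ Nat.log 2 D := Nat.cast_nonneg _
    nlinarith
  have h : (G.thresholdDim : ℝ) ≤ 560 * D * ((Nat.log 2 D : ℝ) + 1) ^ 2 := by
    exact_mod_cast G.thresholdDim_le_mul_natLog_sq hD hdeg
  calc (G.thresholdDim : ℝ) ≤ 560 * D * ((Nat.log 2 D : ℝ) + 1) ^ 2 := h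
    -- The binary logarithm costs a factor `2`, as `log 2 > 1 / 2`, and the summand `1` is at most
    -- `log D`.
    _ ≤ 560 * D * (3 * Real.log D) ^ 2 := by gcongr; linarith
    _ = 5040 * D * Real.log D ^ 2 := by ring

theorem SimpleGraph.thresholdDim_le_of_maxDegree_le {V : Type*} [Fintype V] (G : SimpleGraph V)
    [DecidableRel G.Adj] {D : ℕ} (hD : 32 ≤ D) (hdeg : G.maxDegree ≤ D) :
    (G.thresholdDim : ℝ) ≤ 5040 * D * Real.log D ^ 2 := by
  classical
  refine G.thresholdDim_le_mul_log_sq hD fun v => ?_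
  refine le_trans (le_of_eq ?_) ((G.degree_le_maxDegree v).trans hdeg)
  rw [← SimpleGraph.card_neighborFinset_eq_degree]
  congr 1
  ext w
  simp

theorem thresholdDimsOfMaxDegree_bddAbove (Δ : ℕ) : BddAbove (thresholdDimsOfMaxDegree Δ) := by
  -- For `Δ < 32` the estimate is applied with the larger degree bound `32`.
  refine ⟨⌊5040 * ((max Δ 32 : ℕ) : ℝ) * Real.log (max Δ 32 : ℕ) ^ 2⌋₊, ?_⟩
  classical
  rintro k ⟨n, G, hG, rfl⟩
  exact Nat.le_floor (G.thresholdDim_le_of_maxDegree_le (le_max_right _ _)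
    (hG.le.trans (le_max_left _ _)))

theorem isGreatest_maxThresholdDim (Δ : ℕ) :
    IsGreatest (thresholdDimsOfMaxDegree Δ) (maxThresholdDim Δ) := by
  have hne : (thresholdDimsOfMaxDegree Δ).Nonempty := by
    classical
    refine ⟨_, Δ + 1, ⊤, ?_, rfl⟩
    have h := SimpleGraph.maxDegree_top (V := Fin (Δ + 1))
    rw [Fintype.card_fin, Nat.add_sub_cancel] at h
    convert h
  exact ⟨Nat.sSup_mem hne (thresholdDimsOfMaxDegree_bddAbove Δ),
    fun k hk => le_csSup (thresholdDimsOfMaxDegree_bddAbove Δ) hk⟩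

theorem maxThresholdDim_le {Δ : ℕ} (hΔ : 32 ≤ Δ) :
    (maxThresholdDim Δ : ℝ) ≤ 5040 * Δ * Real.log Δ ^ 2 := by
  classical
  obtain ⟨n, G, hG, hk⟩ := (isGreatest_maxThresholdDim Δ).1
  rw [← hk]
  exact G.thresholdDim_le_of_maxDegree_le hΔ hG.le

end Numerics

/-- All error functions are zero: `5040 ≤ 24300`, and both `log (log Δ)` and the power of `2 * e`
are eventually at least `1`. -/
theorem mainTheorem2 :
    (∃ ε₁ ε₂ : ℕ → ℝ, Tendsto ε₁ atTop (𝓝 0) ∧ Tendsto ε₂ atTop (𝓝 0) ∧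
      ∀ᶠ Δ : ℕ in atTop, ∀ (V : Type*) [Fintype V] (G : SimpleGraph V) [DecidableRel G.Adj],
        G.maxDegree = Δ →
          (G.thresholdDim : ℝ) ≤
            (24300 + ε₁ Δ) * Δ * Real.log Δ ^ 2 * Real.log (Real.log Δ) *
              (2 * Real.exp 1) ^ Real.sqrt ((1 + ε₂ Δ) * Real.log (Real.log Δ))) ∧
    (∀ Δ : ℕ, IsGreatest (thresholdDimsOfMaxDegree Δ) (maxThresholdDim Δ)) ∧
    (∃ η : ℕ → ℝ, Tendsto η atTop (𝓝 0) ∧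
      (fun Δ : ℕ => (maxThresholdDim Δ : ℝ)) =O[atTop]
        fun Δ : ℕ => (Δ : ℝ) * Real.log Δ ^ (2 + η Δ)) := by
  refine ⟨⟨fun _ => 0, fun _ => 0, tendsto_const_nhds, tendsto_const_nhds, ?_⟩,
    isGreatest_maxThresholdDim, fun _ => 0, tendsto_const_nhds, ?_⟩
  · have hloglog : Tendsto (fun Δ : ℕ => Real.log (Real.log Δ)) atTop atTop :=
      Real.tendsto_log_atTop.comp (Real.tendsto_log_atTop.comp tendsto_natCast_atTop_atTop)
    filter_upwards [hloglog.eventually_ge_atTop 1, eventually_ge_atTop 32] with Δ h1 h32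
    intro V _ G _ hG
    refine (G.thresholdDim_le_of_maxDegree_le h32 hG.le).trans ?_
    have h2 : 1 ≤ (2 * Real.exp 1) ^ Real.sqrt ((1 + 0) * Real.log (Real.log Δ)) := by
      refine Real.one_le_rpow ?_ (Real.sqrt_nonneg _)
      have := Real.add_one_le_exp (1 : ℝ)
      linarith
    have h3 : 0 ≤ (Δ : ℝ) * Real.log Δ ^ 2 := by positivity
    calc 5040 * (Δ : ℝ) * Real.log Δ ^ 2 ≤ (24300 + 0) * Δ * Real.log Δ ^ 2 * 1 * 1 := by
          linarith
      _ ≤ _ := by gcongr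
  · refine IsBigO.of_bound 5040 ?_
    filter_upwards [eventually_ge_atTop 32] with Δ h32
    have h0 : 0 ≤ Real.log (Δ : ℝ) := Real.log_natCast_nonneg Δ
    rw [Real.norm_of_nonneg (Nat.cast_nonneg _), add_zero, Real.rpow_two,
      Real.norm_of_nonneg (by positivity), ← mul_assoc]
    exact maxThresholdDim_le h32
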